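/- Consider a discounted POMDP with finite sets of states, observations $\Omega$ and actions, reward $\mathcal R$, discount factor $\gamma\in[0,1)$ and, at each belief $b$, a non-empty set $A(b)$ of legal actions (all actions, for an ordinary POMDP). For a belief $b$ let $R(b,a)$ be the expected reward, $P(o\mid b,a)$ the probability of observing $o$, $\tau(b,a,o)$ the updated belief, $V^*(b)$ the supremum over policies (maps from beliefs to legal actions) of the expected discounted return, and $Q^*(b,a)=R(b,a)+\gamma\sum_o P(o\mid b,a)V^*(\tau(b,a,o))$. A search graph $\mathcal G$ with root $b_0$ is a finite, possibly cyclic graph in which every node carries a belief and is reachable from the root, which carries $b_0$ (equal beliefs may or may not share a node; we write $b$ both for a node and for its belief). Each node is either expanded, and then has an edge to a node with belief $\tau(b,a,o)$ for every $a\in A(b)$ and every $o$ with $P(o\mid b,a)>0$, or it belongs to the fringe $\mathcal F(\mathcal G)$ of nodes without children. Given functions $U,L$ on beliefs, $U_{\mathcal G}$ and $L_{\mathcal G}$ are the unique functions on the nodes with $U_{\mathcal G}=U$ and $L_{\mathcal G}=L$ on the fringe and, at expanded nodes, $U_{\mathcal G}(b)=\max_{a\in A(b)}U_{\mathcal G}(b,a)$,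 $L_{\mathcal G}(b)=\max_{a\in A(b)}L_{\mathcal G}(b,a)$, where $U_{\mathcal G}(b,a)=R(b,a)+\gamma\sum_o P(o\mid b,a)\,U_{\mathcal G}(\tau(b,a,o))$, the sum running over the successors of the node, and likewise for $L_{\mathcal G}(b,a)$. Write $\hat e_{\mathcal G}=U_{\mathcal G}-L_{\mathcal G}$. For a stochastic policy $\pi$ on the nodes and a fringe node $b$, let $\Psi_\pi(b_0,b)=\sum_h\gamma^{d(h)}P(h\mid b_0,\pi)$, the sum over all paths $h=(b_i,a_i,o_{i+1})_{i<d(h)}$ in $\mathcal G$ from the root to $b$, with $P(h\mid b_0,\pi)=\prod_{i<d(h)}P(o_{i+1}\mid b_i,a_i)\,\pi(a_i\mid b_i)$. Fix $\varepsilon>0$ and, for every search graph $\mathcal G$, a stochastic policy $\hat\pi_{\mathcal G}$ and for each expanded node $b$ an action $\hat a_b^{\mathcal G}\in\arg\max_{a\in A(b)}U_{\mathcal G}(b,a)$. AEMS-Loop starts from the graph that consists of the unexpanded root and, as long as $\hat e_{\mathcal G}(b_0)>\varepsilon$, expands a fringe node $b$ that maximizes $\Psi_{\hat\pi_{\mathcal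 G}}(b_0,b)\,(U(b)-L(b))$ (ties broken arbitrarily). **Theorem.** Let $U$ be bounded above and $L$ bounded below with $U(b)\ge V^*(b)\ge L(b)$ for all beliefs $b$, and suppose that $$\inf\{\hat\pi_{\mathcal G}(b,\hat a_b^{\mathcal G}) : \mathcal G \text{ a search graph with root } b_0,\ b \text{ an expanded node of } \mathcal G,\ \hat e_{\mathcal G}(b)>\varepsilon\}>0 .$$ Then AEMS-Loop is complete and $\varepsilon$-optimal: after finitely many expansions it reaches a graph $\mathcal G$ with $U_{\mathcal G}(b_0)-L_{\mathcal G}(b_0)\le\varepsilon$, and for this graph $L_{\mathcal G}(b_0)\le V^*(b_0)\le U_{\mathcal G}(b_0)$, so that $V^*(b_0)-L_{\mathcal G}(b_0)\le\varepsilon$; moreover, if the root has been expanded, every action $a$ that maximizes $L_{\mathcal G}(b_0,a)$ satisfies $Q^*(b_0,a)\ge V^*(b_0)-\varepsilon$. -/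

import Mathlib

noncomputable section

/-- A belief over a finite set `S`: a point of the probability simplex. -/
abbrev Belief (S : Type*) [Fintype S] : Type _ := ↥(stdSimplex ℝ S)

/-- A finite discounted POMDP. `trans s a s'` is the probability of moving from `s` to `s'` under `a`,
`obs s' a o` the probability of observing `o` when `a` led to `s'`. The set of legal actions may depend on
the belief (as in the POMDP that encodes state requests, where request decisions and environmental
actions alternate); the ordinary POMDP is the case where it is always the set of all actions. -/
structure POMDP (S Ω A : Type*) [Fintype S] [Fintype Ω] [Fintype A] where
  trans : S → A → ↥(stdSimplex ℝ S)
  obs : S → A → ↥(stdSimplex ℝ Ω)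
  reward : S → A → ℝ
  discount : ℝ
  discount_nonneg : 0 ≤ discount
  discount_lt_one : discount < 1
  legal : Belief S → Finset A
  legal_nonempty : ∀ b, (legal b).Nonempty

namespace POMDP

variable {S Ω A : Type*} [Fintype S] [Fintype Ω] [Fintype A] (M : POMDP S Ω A)

/-- `R(b, a)`, the expected immediate reward. -/
def beliefReward (b : Belief S) (a : A) : ℝ := ∑ s, b.1 s * M.reward s a

/-- The probability that, from belief `b` and under `a`, the next state is `s'` and `o` is observed. -/
def jointProb (b : Belief S) (a : A) (o : Ω) (s' : S) : ℝ :=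
  (∑ s, b.1 s * (M.trans s a).1 s') * (M.obs s' a).1 o

/-- `P(o | b, a)`. -/
def obsProb (b : Belief S) (a : A) (o : Ω) : ℝ := ∑ s', M.jointProb b a o s'

theorem jointProb_nonneg (b : Belief S) (a : A) (o : Ω) (s' : S) : 0 ≤ M.jointProb b a o s' :=
  mul_nonneg (Finset.sum_nonneg fun s _ => mul_nonneg (b.2.1 s) ((M.trans s a).2.1 s'))
    ((M.obs s' a).2.1 o)

theorem obsProb_nonneg (b : Belief S) (a : A) (o : Ω) : 0 ≤ M.obsProb b a o :=
  Finset.sum_nonneg fun s' _ => M.jointProb_nonneg b a o s'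

theorem sum_obsProb (b : Belief S) (a : A) : ∑ o, M.obsProb b a o = 1 := by
  simp only [obsProb, jointProb]
  rw [Finset.sum_comm]
  simp only [← Finset.mul_sum, (M.obs _ a).2.2, mul_one]
  rw [Finset.sum_comm]
  simp only [← Finset.mul_sum, (M.trans _ a).2.2, mul_one]
  exact b.2.2

open Classical in
/-- `τ(b, a, o)`, the Bayesian belief update, meaningful for observations of positive probability
(an observation of probability `0` never matters, and the value is then set to `b`). -/
def update (b : Belief S) (a : A) (o : Ω) : Belief S :=
  if h : 0 < M.obsProb b a o then
    ⟨fun s' => M.jointProb b a o s' / M.obsProb b a o,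
      fun s' => div_nonneg (M.jointProb_nonneg b a o s') h.le, by
        rw [← Finset.sum_div]
        exact div_self h.ne'⟩
  else b

/-- The expected reward received at time `t` when starting in `b` and following the policy `π`. -/
def rewardAt (π : Belief S → A) : ℕ → Belief S → ℝ
  | 0, b => M.beliefReward b (π b)
  | t + 1, b => ∑ o, M.obsProb b (π b) o * rewardAt π t (M.update b (π b) o)

/-- `V^π(b)`, the expected discounted return of the policy `π` from `b`. -/
def policyValue (π : Belief S → A) (b : Belief S) : ℝ :=
  ∑' t, M.discount ^ t * M.rewardAt π t b

/-- `V*(b)`, the supremum of the values at `b` of all policies (mappings from beliefs to legal actions). -/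
def optValue (b : Belief S) : ℝ :=
  ⨆ π : {π : Belief S → A // ∀ b', π b' ∈ M.legal b'}, M.policyValue π.1 b

/-- `Q*(b, a)`, the return of taking `a` in `b` and acting optimally afterwards. -/
def optQ (b : Belief S) (a : A) : ℝ :=
  M.beliefReward b a + M.discount * ∑ o, M.obsProb b a o * M.optValue (M.update b a o)

end POMDP

/-- The nodes that a graph search from the belief `b₀` may generate. Every node carries a belief, and
`child n a o` is the node that becomes the successor of `n` along the edge `(a, o)` when `n` is
expanded. Equal beliefs may be represented by one node (with `N` the set of beliefs and `bel` the identity,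
all of them are), by several, or never be merged (with `N` the set of histories, the search space is a
tree). In particular cycles are allowed. -/
structure SearchSpace {S Ω A : Type*} [Fintype S] [Fintype Ω] [Fintype A]
    (M : POMDP S Ω A) (b₀ : Belief S) (N : Type*) where
  bel : N → Belief S
  root : N
  child : N → A → Ω → N
  bel_root : bel root = b₀
  bel_child : ∀ n a o, a ∈ M.legal (bel n) → 0 < M.obsProb (bel n) a o →
    bel (child n a o) = M.update (bel n) a o

namespace SearchSpace

variable {S Ω A : Type*} [Fintype S] [Fintype Ω] [Fintype A] {M : POMDP S Ω A} {b₀ : Belief S}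
  {N : Type*} (W : SearchSpace M b₀ N)

/-- `W.IsPath X n h m`: the sequence `h` of actions and observations is a path from `n` to `m` in the
graph in which exactly the nodes of `X` are expanded. An expanded node has one outgoing edge for each
legal action and each observation of positive probability. -/
def IsPath (X : Set N) : N → List (A × Ω) → N → Prop
  | n, [], m => n = m
  | n, (a, o) :: h, m =>
    n ∈ X ∧ a ∈ M.legal (W.bel n) ∧ 0 < M.obsProb (W.bel n) a o ∧ IsPath X (W.child n a o) h m

/-- A finite rooted search graph, given by its set of expanded nodes, all of them reachable from the root
within the graph. -/
@[ext]
structure Graph where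
  expanded : Set N
  finite : expanded.Finite
  reachable : ∀ n ∈ expanded, ∃ h, W.IsPath expanded W.root h n

/-- `F(G)`, the fringe: the nodes of the graph (those reachable from the root) without children. -/
def fringe (G : W.Graph) : Set N :=
  {n | (∃ h, W.IsPath G.expanded W.root h n) ∧ n ∉ G.expanded}

/-- `R(b, a) + γ ∑ₒ P(o | b, a) f(τ(b, a, o))` at the node `n` with belief `b`. -/
def backup (f : N → ℝ) (n : N) (a : A) : ℝ :=
  M.beliefReward (W.bel n) a + M.discount * ∑ o, M.obsProb (W.bel n) a o * f (W.child n a o)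

/-- The maximum of `W.backup f n a` over the legal actions `a`. -/
def backupMax (f : N → ℝ) (n : N) : ℝ :=
  (M.legal (W.bel n)).sup' (M.legal_nonempty _) (W.backup f n)

open Classical in
/-- The equations for the values propagated in the graph with set `X` of expanded nodes: the offline
bound `B` at nodes that are not expanded, the maximal backed up value at expanded nodes. -/
def IsGraphValue (X : Set N) (B : Belief S → ℝ) (f : N → ℝ) : Prop :=
  ∀ n, f n = if n ∈ X then W.backupMax f n else B (W.bel n)

theorem backupMax_le {f g : N → ℝ} {c : ℝ} (h : ∀ n, f n ≤ g n + c) (n : N) :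
    W.backupMax f n ≤ W.backupMax g n + M.discount * c := by
  refine Finset.sup'_le _ _ fun a ha => ?_
  have h1 : W.backup f n a ≤ W.backup g n a + M.discount * c := by
    have h2 : ∑ o, M.obsProb (W.bel n) a o * f (W.child n a o) ≤
        ∑ o, M.obsProb (W.bel n) a o * g (W.child n a o) + c := by
      calc _ ≤ ∑ o, M.obsProb (W.bel n) a o * (g (W.child n a o) + c) :=
            Finset.sum_le_sum fun o _ =>
              mul_le_mul_of_nonneg_left (h _) (M.obsProb_nonneg _ _ _)
        _ = _ := by
            simp only [mul_add, Finset.sum_add_distrib]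
            rw [← Finset.sum_mul, M.sum_obsProb, one_mul]
    have h3 := mul_le_mul_of_nonneg_left h2 M.discount_nonneg
    unfold backup
    linarith
  exact h1.trans (add_le_add (Finset.le_sup' (W.backup g n) ha) le_rfl)

theorem existsUnique_isGraphValue {X : Set N} (hX : X.Finite) (B : Belief S → ℝ) :
    ∃! f, W.IsGraphValue X B f := by
  classical
  have : Fintype X := hX.fintype
  let e : (X → ℝ) → N → ℝ := fun f n => if h : n ∈ X then f ⟨n, h⟩ else B (W.bel n)
  let Φ : (X → ℝ) → (X → ℝ) := fun f x => W.backupMax (e f) x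
  have he : ∀ f g : X → ℝ, ∀ n, e f n ≤ e g n + dist f g := by
    intro f g n
    by_cases h : n ∈ X
    · have h1 := (le_abs_self _).trans (dist_le_pi_dist f g ⟨n, h⟩)
      simp only [e, h, dite_true]
      linarith
    · simp only [e, h, dite_false]
      linarith [dist_nonneg (x := f) (y := g)]
  have hΦ : ContractingWith ⟨M.discount, M.discount_nonneg⟩ Φ := by
    refine ⟨by exact_mod_cast M.discount_lt_one, LipschitzWith.of_dist_le_mul fun f g => ?_⟩
    refine (dist_pi_le_iff (mul_nonneg M.discount_nonneg dist_nonneg)).2 fun x => ?_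
    have h1 := W.backupMax_le (he f g) x
    have h2 := W.backupMax_le (he g f) x
    rw [dist_comm g f] at h2
    rw [Real.dist_eq, abs_sub_le_iff]
    constructor
    · exact sub_le_iff_le_add'.2 h1
    · exact sub_le_iff_le_add'.2 h2
  have key : ∀ f, W.IsGraphValue X B f → e (fun x => f x) = f ∧ Φ (fun x => f x) = fun x : X => f x := by
    intro f hf
    have h1 : e (fun x => f x) = f := by
      funext n
      by_cases h : n ∈ X
      · simp [e, h]
      · rw [hf n]
        simp [e, h]
    refine ⟨h1, ?_⟩
    funext x
    simp only [Φ, h1]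
    rw [hf x]
    simp
  obtain ⟨φ, h1, h2⟩ : ∃ φ : X → ℝ, Φ φ = φ ∧ ∀ ψ, Φ ψ = ψ → ψ = φ :=
    ⟨hΦ.fixedPoint, hΦ.fixedPoint_isFixedPt, fun _ h => hΦ.fixedPoint_unique h⟩
  refine ⟨e φ, fun n => ?_, fun f hf => ?_⟩
  · by_cases h : n ∈ X
    · have h3 : e φ n = φ ⟨n, h⟩ := dif_pos h
      rw [if_pos h, h3]
      exact (congrFun h1 ⟨n, h⟩).symm
    · rw [if_neg h]
      exact dif_neg h
  · obtain ⟨h3, h4⟩ := key f hf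
    have h5 : (fun x : X => f x) = φ := h2 _ h4
    exact (h5 ▸ h3.symm : f = e φ)

/-- The values propagated in `G` from the offline bound `B`: the unique solution of the equations.
With `B = U` and `B = L` these are `U_G` and `L_G`. -/
def graphValue (G : W.Graph) (B : Belief S → ℝ) : N → ℝ :=
  (W.existsUnique_isGraphValue G.finite B).choose

theorem isGraphValue_graphValue (G : W.Graph) (B : Belief S → ℝ) :
    W.IsGraphValue G.expanded B (W.graphValue G B) :=
  (W.existsUnique_isGraphValue G.finite B).choose_spec.1

/-- The approximate error gap `U_G - L_G` at a node. -/
def gap (U L : Belief S → ℝ) (G : W.Graph) (n : N) : ℝ :=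
  W.graphValue G U n - W.graphValue G L n

/-- `a` is a legal action at `n` that maximizes the value backed up from `f`. -/
def IsGreedy (f : N → ℝ) (n : N) (a : A) : Prop :=
  a ∈ M.legal (W.bel n) ∧ ∀ a' ∈ M.legal (W.bel n), W.backup f n a' ≤ W.backup f n a

/-- The probability of observing the path `h` from `n` when following the stochastic policy `π`. -/
def pathProb (π : N → ↥(stdSimplex ℝ A)) : N → List (A × Ω) → ℝ
  | _, [] => 1
  | n, (a, o) :: h => M.obsProb (W.bel n) a o * (π n).1 a * pathProb π (W.child n a o) h

/-- `Ψ_π(b₀, n)`: the sum over all paths in `G` from the root to `n` of their probabilities, each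
discounted by the length of the path. -/
def Psi (G : W.Graph) (π : N → ↥(stdSimplex ℝ A)) (n : N) : ℝ :=
  ∑' h : {h : List (A × Ω) // W.IsPath G.expanded W.root h n},
    M.discount ^ h.1.length * W.pathProb π W.root h.1

/-- The heuristic `Ψ_π(b₀, n) (U(n) - L(n))`. -/
def contribution (U L : Belief S → ℝ) (G : W.Graph) (π : N → ↥(stdSimplex ℝ A)) (n : N) : ℝ :=
  W.Psi G π n * (U (W.bel n) - L (W.bel n))

/-- `G 0, G 1, …` is an execution of AEMS-Loop with error threshold `ε` and approximate policies `π G`: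
it starts with the graph that only has the (unexpanded) root; as long as the gap at the root exceeds `ε`
and there is a fringe node, a fringe node of maximal contribution is expanded; otherwise the
execution has halted and the graph does not change any more. -/
def IsRun (U L : Belief S → ℝ) (ε : ℝ) (π : W.Graph → N → ↥(stdSimplex ℝ A))
    (G : ℕ → W.Graph) : Prop :=
  (G 0).expanded = ∅ ∧ ∀ t,
    ((ε < W.gap U L (G t) W.root ∧ (W.fringe (G t)).Nonempty) →
      ∃ n ∈ W.fringe (G t),
        (∀ m ∈ W.fringe (G t),
          W.contribution U L (G t) (π (G t)) m ≤ W.contribution U L (G t) (π (G t)) n) ∧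
        (G (t + 1)).expanded = insert n (G t).expanded) ∧
    (¬ (ε < W.gap U L (G t) W.root ∧ (W.fringe (G t)).Nonempty) → G (t + 1) = G t)

end SearchSpace

end

open Filter Topology

/-! Soundness is a comparison argument: $V^*$ solves the Bellman equation (`optValue_eq_sup'`), so
on any finite graph it lies between the values propagated from $L$ and from $U$ (`le_of_backupMax`).
Cycles do no harm, because backups contract by $\gamma$.

Termination is a pigeonhole argument. Suppose the root gap stays above $\varepsilon$. Along a
$U$-greedy action the gap is at most $\gamma$ times an average of successor gaps, so some
observation leads to a gap larger by a factor $1/\gamma$. As gaps are bounded by $D$, iterating this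
must leave the graph within a number of steps independent of the graph. The path found has
discounted probability at least some $\delta>0$, also independent of the graph, so some fringe node
always contributes at least $\delta\varepsilon$ (`exists_path_of_lt_gap`). A node all of whose paths
have length at least $K$ contributes at most $\gamma^K D/(1-\gamma)$ (`Psi_le_of_le_length`). Hence
every expanded node lies within a fixed distance of the root. There are only finitely many such
nodes (`finite_near`), and none is expanded twice. -/

/-- A function bounded above whose nonnegative upper bounds contract by the factor `c < 1` is nonpositive. -/
theorem nonpos_of_upperBound_contracts {X : Type*} {f : X → ℝ} {c : ℝ} (hc0 : 0 ≤ c) (hc1 : c < 1)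
    (hf : ∃ C, ∀ x, f x ≤ C) (h : ∀ C, 0 ≤ C → (∀ x, f x ≤ C) → ∀ x, f x ≤ c * C) (x : X) :
    f x ≤ 0 := by
  obtain ⟨C, hC⟩ := hf
  -- The bound `C` may be negative, while `h` only accepts nonnegative ones.
  have key : ∀ k : ℕ, ∀ x, f x ≤ c ^ k * max C 0 := by
    intro k
    induction k with
    | zero => intro x; simpa using Or.inl (hC x)
    | succ k ih =>
      intro x
      rw [pow_succ', mul_assoc]
      exact h _ (mul_nonneg (pow_nonneg hc0 k) (le_max_right _ _)) ih x
  have hlim : Tendsto (fun k : ℕ => c ^ k * max C 0) atTop (𝓝 0) := by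
    simpa using (tendsto_pow_atTop_nhds_zero_of_lt_one hc0 hc1).mul_const (max C 0)
  exact ge_of_tendsto' hlim fun k => key k x

/-! ### Policy values and the Bellman optimality equation. -/

namespace POMDP

variable {S Ω A : Type*} [Fintype S] [Fintype Ω] [Fintype A] (M : POMDP S Ω A)

theorem sum_obsProb_mul_le (b : Belief S) (a : A) {f : Ω → ℝ} {C : ℝ} (h : ∀ o, f o ≤ C) :
    ∑ o, M.obsProb b a o * f o ≤ C :=
  calc _ ≤ ∑ o, M.obsProb b a o * C :=
        Finset.sum_le_sum fun o _ => mul_le_mul_of_nonneg_left (h o) (M.obsProb_nonneg _ _ _)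
    _ = C := by rw [← Finset.sum_mul, M.sum_obsProb, one_mul]

theorem abs_sum_obsProb_mul_le (b : Belief S) (a : A) {f : Ω → ℝ} {C : ℝ} (h : ∀ o, |f o| ≤ C) :
    |∑ o, M.obsProb b a o * f o| ≤ C := by
  refine (Finset.abs_sum_le_sum_abs _ _).trans ?_
  simp only [abs_mul, abs_of_nonneg (M.obsProb_nonneg _ _ _)]
  exact M.sum_obsProb_mul_le b a h

theorem exists_abs_beliefReward_le : ∃ C, ∀ b a, |M.beliefReward b a| ≤ C := by
  refine ⟨∑ s, ∑ a, |M.reward s a|, fun b a => ?_⟩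
  refine (Finset.abs_sum_le_sum_abs _ _).trans (Finset.sum_le_sum fun s _ => ?_)
  rw [abs_mul, abs_of_nonneg (b.2.1 s)]
  have h1 : b.1 s ≤ 1 := by
    rw [← b.2.2]
    exact Finset.single_le_sum (fun i _ => b.2.1 i) (Finset.mem_univ s)
  exact (mul_le_of_le_one_left (abs_nonneg _) h1).trans
    (Finset.single_le_sum (f := fun a => |M.reward s a|) (fun i _ => abs_nonneg _)
      (Finset.mem_univ a))

theorem abs_rewardAt_le {C : ℝ} (hC : ∀ b a, |M.beliefReward b a| ≤ C) (π : Belief S → A) (t : ℕ)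
    (b : Belief S) : |M.rewardAt π t b| ≤ C := by
  induction t generalizing b with
  | zero => exact hC _ _
  | succ t ih => exact M.abs_sum_obsProb_mul_le _ _ fun o => ih _

theorem norm_discounted_rewardAt_le {C : ℝ} (hC : ∀ b a, |M.beliefReward b a| ≤ C)
    (π : Belief S → A) (b : Belief S) (t : ℕ) :
    ‖M.discount ^ t * M.rewardAt π t b‖ ≤ M.discount ^ t * C := by
  rw [Real.norm_eq_abs, abs_mul, abs_of_nonneg (pow_nonneg M.discount_nonneg t)]
  exact mul_le_mul_of_nonneg_left (M.abs_rewardAt_le hC π t b) (pow_nonneg M.discount_nonneg t)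

theorem hasSum_discount_pow : HasSum (fun t : ℕ => M.discount ^ t) (1 - M.discount)⁻¹ :=
  hasSum_geometric_of_lt_one M.discount_nonneg M.discount_lt_one

theorem summable_discounted_rewardAt (π : Belief S → A) (b : Belief S) :
    Summable fun t => M.discount ^ t * M.rewardAt π t b := by
  obtain ⟨C, hC⟩ := M.exists_abs_beliefReward_le
  exact Summable.of_norm_bounded (M.hasSum_discount_pow.summable.mul_right C)
    (M.norm_discounted_rewardAt_le hC π b)

theorem exists_abs_policyValue_le : ∃ C, ∀ π b, |M.policyValue π b| ≤ C := by
  obtain ⟨C, hC⟩ := M.exists_abs_beliefReward_le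
  exact ⟨_, fun π b => tsum_of_norm_bounded (M.hasSum_discount_pow.mul_right C)
    (M.norm_discounted_rewardAt_le hC π b)⟩

theorem policyValue_eq (π : Belief S → A) (b : Belief S) :
    M.policyValue π b = M.beliefReward b (π b) +
      M.discount * ∑ o, M.obsProb b (π b) o * M.policyValue π (M.update b (π b) o) := by
  unfold policyValue
  rw [(M.summable_discounted_rewardAt π b).tsum_eq_zero_add]
  congr 1
  · simp [rewardAt]
  · simp only [← tsum_mul_left]
    rw [← Summable.tsum_finsetSum fun o _ =>
      (M.summable_discounted_rewardAt π _).mul_left _, ← tsum_mul_left]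
    refine tsum_congr fun t => ?_
    simp only [rewardAt, Finset.mul_sum]
    exact Finset.sum_congr rfl fun o _ => by ring

theorem bddAbove_policyValue (b : Belief S) :
    BddAbove (Set.range fun π : {π : Belief S → A // ∀ b', π b' ∈ M.legal b'} =>
      M.policyValue π.1 b) := by
  obtain ⟨C, hC⟩ := M.exists_abs_policyValue_le
  refine ⟨C, ?_⟩
  rintro _ ⟨π, rfl⟩
  exact (le_abs_self _).trans (hC _ _)

theorem policyValue_le_optValue {π : Belief S → A} (hπ : ∀ b, π b ∈ M.legal b) (b : Belief S) :
    M.policyValue π b ≤ M.optValue b :=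
  le_ciSup (M.bddAbove_policyValue b) ⟨π, hπ⟩

theorem optValue_le {b : Belief S} {C : ℝ}
    (h : ∀ π : Belief S → A, (∀ b', π b' ∈ M.legal b') → M.policyValue π b ≤ C) :
    M.optValue b ≤ C := by
  have : Nonempty {π : Belief S → A // ∀ b', π b' ∈ M.legal b'} :=
    ⟨⟨fun b => (M.legal_nonempty b).choose, fun b => (M.legal_nonempty b).choose_spec⟩⟩
  exact ciSup_le fun π => h π.1 π.2

theorem policyValue_le_optQ {π : Belief S → A} (hπ : ∀ b, π b ∈ M.legal b) (b : Belief S) :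
    M.policyValue π b ≤ M.optQ b (π b) := by
  rw [policyValue_eq, optQ]
  have h := Finset.sum_le_sum fun o (_ : o ∈ Finset.univ) =>
    mul_le_mul_of_nonneg_left (M.policyValue_le_optValue hπ (M.update b (π b) o))
      (M.obsProb_nonneg b (π b) o)
  linarith [mul_le_mul_of_nonneg_left h M.discount_nonneg]

/-- The Bellman optimality equation. -/
theorem optValue_eq_sup' (b : Belief S) :
    M.optValue b = (M.legal b).sup' (M.legal_nonempty b) (M.optQ b) := by
  -- The policy that is greedy for $Q^*$ turns out to attain $V^*$ at every belief.
  choose π hπ hmax using fun b => Finset.exists_mem_eq_sup' (M.legal_nonempty b) (M.optQ b)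
  have hle : ∀ b, M.optValue b ≤ M.optQ b (π b) := fun b => M.optValue_le fun π' hπ' =>
    (M.policyValue_le_optQ hπ' b).trans ((Finset.le_sup' _ (hπ' b)).trans_eq (hmax b))
  have hsub : ∀ b, M.optValue b - M.policyValue π b ≤ 0 := by
    refine nonpos_of_upperBound_contracts M.discount_nonneg M.discount_lt_one ?_ ?_
    · obtain ⟨C, hC⟩ := M.exists_abs_policyValue_le
      refine ⟨C + C, fun b => ?_⟩
      linarith [M.optValue_le fun π' _ => (le_abs_self _).trans (hC π' b), (abs_le.1 (hC π b)).1]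
    · intro C _ hC b
      have h1 := M.sum_obsProb_mul_le b (π b) fun o => hC (M.update b (π b) o)
      simp only [mul_sub, Finset.sum_sub_distrib] at h1
      have h2 := mul_le_mul_of_nonneg_left h1 M.discount_nonneg
      have h3 := hle b
      rw [optQ] at h3
      rw [policyValue_eq]
      linarith
  have heq : ∀ b, M.policyValue π b = M.optValue b := fun b =>
    (M.policyValue_le_optValue hπ b).antisymm (sub_nonpos.1 (hsub b))
  rw [hmax, ← heq, policyValue_eq, optQ]
  simp only [heq]

end POMDP

/-! ### Propagated bounds and the gap in a finite graph. -/

namespace SearchSpace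

variable {S Ω A : Type*} [Fintype S] [Fintype Ω] [Fintype A] {M : POMDP S Ω A} {b₀ : Belief S}
  {N : Type*} (W : SearchSpace M b₀ N)

theorem backup_mono {f g : N → ℝ} (h : ∀ n, f n ≤ g n) (n : N) (a : A) :
    W.backup f n a ≤ W.backup g n a := by
  have h1 := Finset.sum_le_sum fun o (_ : o ∈ Finset.univ) =>
    mul_le_mul_of_nonneg_left (h (W.child n a o)) (M.obsProb_nonneg (W.bel n) a o)
  have h2 := mul_le_mul_of_nonneg_left h1 M.discount_nonneg
  unfold backup
  linarith

/-- The belief of a child is prescribed only for observations of positive probability; the other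
children have weight zero. -/
theorem backup_optValue {n : N} {a : A} (ha : a ∈ M.legal (W.bel n)) :
    W.backup (fun m => M.optValue (W.bel m)) n a = M.optQ (W.bel n) a := by
  unfold backup POMDP.optQ
  congr 2
  refine Finset.sum_congr rfl fun o _ => ?_
  rcases (M.obsProb_nonneg (W.bel n) a o).eq_or_lt with h | h
  · simp [← h]
  · rw [← W.bel_child n a o ha h]

theorem backupMax_optValue (n : N) :
    W.backupMax (fun m => M.optValue (W.bel m)) n = M.optValue (W.bel n) := by
  rw [M.optValue_eq_sup']
  exact Finset.sup'_congr _ rfl fun a ha => W.backup_optValue ha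

/-- Comparison principle for the equations of a finite graph. -/
theorem le_of_backupMax {X : Set N} (hX : X.Finite) {f g : N → ℝ}
    (hf : ∀ n ∈ X, f n ≤ W.backupMax f n) (hg : ∀ n ∈ X, W.backupMax g n ≤ g n)
    (hfg : ∀ n ∉ X, f n ≤ g n) (n : N) : f n ≤ g n := by
  refine sub_nonpos.1 (nonpos_of_upperBound_contracts (f := fun n => f n - g n)
    M.discount_nonneg M.discount_lt_one ?_ ?_ n)
  -- Finiteness of `X` supplies the upper bound: outside `X` the difference is nonpositive.
  · obtain ⟨C, hC⟩ := (hX.image fun n => f n - g n).bddAbove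
    refine ⟨max C 0, fun n => ?_⟩
    by_cases hn : n ∈ X
    · exact (hC ⟨n, hn, rfl⟩).trans (le_max_left _ _)
    · exact (sub_nonpos.2 (hfg n hn)).trans (le_max_right _ _)
  · intro C hC h n
    by_cases hn : n ∈ X
    · have := W.backupMax_le (f := f) (g := g) (c := C) (fun m => by linarith [h m]) n
      linarith [hf n hn, hg n hn]
    · exact (sub_nonpos.2 (hfg n hn)).trans (mul_nonneg M.discount_nonneg hC)

theorem graphValue_of_mem (G : W.Graph) (B : Belief S → ℝ) {n : N} (hn : n ∈ G.expanded) :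
    W.graphValue G B n = W.backupMax (W.graphValue G B) n :=
  (W.isGraphValue_graphValue G B n).trans (if_pos hn)

theorem graphValue_of_notMem (G : W.Graph) (B : Belief S → ℝ) {n : N} (hn : n ∉ G.expanded) :
    W.graphValue G B n = B (W.bel n) :=
  (W.isGraphValue_graphValue G B n).trans (if_neg hn)

theorem optValue_le_graphValue (G : W.Graph) {U : Belief S → ℝ} (hU : ∀ b, M.optValue b ≤ U b)
    (n : N) : M.optValue (W.bel n) ≤ W.graphValue G U n :=
  W.le_of_backupMax (f := fun m => M.optValue (W.bel m)) G.finite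
    (fun _ _ => (W.backupMax_optValue _).ge) (fun _ hn => (W.graphValue_of_mem G U hn).ge)
    (fun _ hn => (hU _).trans_eq (W.graphValue_of_notMem G U hn).symm) n

theorem graphValue_le_optValue (G : W.Graph) {L : Belief S → ℝ} (hL : ∀ b, L b ≤ M.optValue b)
    (n : N) : W.graphValue G L n ≤ M.optValue (W.bel n) :=
  W.le_of_backupMax (g := fun m => M.optValue (W.bel m)) G.finite
    (fun _ hn => (W.graphValue_of_mem G L hn).le) (fun _ _ => (W.backupMax_optValue _).le)
    (fun _ hn => (W.graphValue_of_notMem G L hn).trans_le (hL _)) n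

theorem graphValue_eq_backup (G : W.Graph) (B : Belief S → ℝ) {n : N} (hn : n ∈ G.expanded) {a : A}
    (ha : W.IsGreedy (W.graphValue G B) n a) :
    W.graphValue G B n = W.backup (W.graphValue G B) n a := by
  rw [W.graphValue_of_mem G B hn]
  exact (Finset.sup'_le _ _ ha.2).antisymm (Finset.le_sup' _ ha.1)

/-- The upper value equals its backup along `a`, the lower value is at least its own backup along
the same `a`, and the rewards cancel. -/
theorem gap_le_sum (G : W.Graph) (U L : Belief S → ℝ) {n : N} (hn : n ∈ G.expanded) {a : A}
    (ha : W.IsGreedy (W.graphValue G U) n a) :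
    W.gap U L G n ≤ M.discount * ∑ o, M.obsProb (W.bel n) a o * W.gap U L G (W.child n a o) := by
  have h1 := W.graphValue_eq_backup G U hn ha
  have h2 : W.backup (W.graphValue G L) n a ≤ W.graphValue G L n := by
    rw [W.graphValue_of_mem G L hn]
    exact Finset.le_sup' (W.backup (W.graphValue G L) n) ha.1
  unfold backup at h1 h2
  simp only [gap, mul_sub, Finset.sum_sub_distrib]
  linarith

theorem gap_of_notMem (G : W.Graph) (U L : Belief S → ℝ) {n : N} (hn : n ∉ G.expanded) :
    W.gap U L G n = U (W.bel n) - L (W.bel n) := by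
  rw [gap, W.graphValue_of_notMem G U hn, W.graphValue_of_notMem G L hn]

theorem exists_isGreedy (f : N → ℝ) (n : N) : ∃ a, W.IsGreedy f n a := by
  obtain ⟨a, ha, h⟩ := Finset.exists_max_image _ (W.backup f n) (M.legal_nonempty (W.bel n))
  exact ⟨a, ha, h⟩

theorem gap_le (G : W.Graph) {U L : Belief S → ℝ} {D : ℝ} (hD0 : 0 ≤ D)
    (hD : ∀ b, U b - L b ≤ D) (n : N) : W.gap U L G n ≤ D := by
  refine sub_nonpos.1 (nonpos_of_upperBound_contracts (f := fun n => W.gap U L G n - D)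
    M.discount_nonneg M.discount_lt_one ?_ ?_ n)
  · obtain ⟨C, hC⟩ := (G.finite.image fun n => W.gap U L G n - D).bddAbove
    refine ⟨max C 0, fun n => ?_⟩
    by_cases hn : n ∈ G.expanded
    · exact (hC ⟨n, hn, rfl⟩).trans (le_max_left _ _)
    · rw [W.gap_of_notMem G U L hn]
      exact (sub_nonpos.2 (hD _)).trans (le_max_right _ _)
  · intro C hC h n
    by_cases hn : n ∈ G.expanded
    · obtain ⟨a, ha⟩ := W.exists_isGreedy (W.graphValue G U) n
      have h1 := M.sum_obsProb_mul_le (W.bel n) a (f := fun o => W.gap U L G (W.child n a o))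
        (C := D + C) fun o => by linarith [h (W.child n a o)]
      have h2 := mul_le_mul_of_nonneg_left h1 M.discount_nonneg
      have h3 := mul_le_of_le_one_left hD0 M.discount_lt_one.le
      linarith [W.gap_le_sum G U L hn ha]
    · rw [W.gap_of_notMem G U L hn]
      exact (sub_nonpos.2 (hD _)).trans (mul_nonneg M.discount_nonneg hC)

/-- Otherwise every discounted gap at a successor of positive probability would be smaller than the
gap at `n`, and so would their average, against `gap_le_sum`. -/
theorem exists_gap_le_discount_mul (G : W.Graph) (U L : Belief S → ℝ) {n : N}
    (hn : n ∈ G.expanded) {a : A} (ha : W.IsGreedy (W.graphValue G U) n a) :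
    ∃ o, 0 < M.obsProb (W.bel n) a o ∧
      W.gap U L G n ≤ M.discount * W.gap U L G (W.child n a o) := by
  by_contra! h
  have h1 := W.gap_le_sum G U L hn ha
  rw [Finset.mul_sum] at h1
  refine h1.not_gt ?_
  calc _ < ∑ o, M.obsProb (W.bel n) a o * W.gap U L G n := ?_
    _ = _ := by rw [← Finset.sum_mul, M.sum_obsProb, one_mul]
  refine Finset.sum_lt_sum (fun o _ => ?_) ?_
  · rcases (M.obsProb_nonneg (W.bel n) a o).eq_or_lt with h0 | h0
    · simp [← h0]
    · rw [mul_left_comm]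
      exact mul_le_mul_of_nonneg_left (h o h0).le h0.le
  · obtain ⟨o, ho, hpos⟩ := Finset.exists_lt_of_sum_lt (s := Finset.univ) (f := fun _ : Ω => (0 : ℝ))
      (g := M.obsProb (W.bel n) a) (by simp [M.sum_obsProb])
    refine ⟨o, ho, ?_⟩
    rw [mul_left_comm]
    exact mul_lt_mul_of_pos_left (h o hpos) hpos

/-! ### Paths -/

theorem IsPath.mono {X Y : Set N} (hXY : X ⊆ Y) {n m : N} {h : List (A × Ω)}
    (hp : W.IsPath X n h m) : W.IsPath Y n h m := by
  induction h generalizing n with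
  | nil => exact hp
  | cons x h ih =>
    obtain ⟨h1, h2, h3, h4⟩ := hp
    exact ⟨hXY h1, h2, h3, ih h4⟩

theorem IsPath.eq_foldl {X : Set N} {n m : N} {h : List (A × Ω)} (hp : W.IsPath X n h m) :
    m = h.foldl (fun k x => W.child k x.1 x.2) n := by
  induction h generalizing n with
  | nil => exact Eq.symm hp
  | cons x h ih => exact ih hp.2.2.2

theorem IsPath.eq_or_exists_child {X : Set N} {n m : N} {h : List (A × Ω)}
    (hp : W.IsPath X n h m) : m = n ∨ ∃ k ∈ X, ∃ x : A × Ω, W.child k x.1 x.2 = m := by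
  induction h generalizing n with
  | nil => exact Or.inl (Eq.symm hp)
  | cons x h ih =>
    obtain ⟨h1, -, -, h4⟩ := hp
    rcases ih h4 with h5 | h5
    · exact Or.inr ⟨n, h1, x, h5.symm⟩
    · exact Or.inr h5

theorem finite_fringe (G : W.Graph) : (W.fringe G).Finite := by
  refine (((G.finite.prod (Set.finite_univ (α := A × Ω))).image
    fun p => W.child p.1 p.2.1 p.2.2).insert W.root).subset ?_
  rintro m ⟨⟨h, hp⟩, -⟩
  rcases hp.eq_or_exists_child with h1 | ⟨k, hk, x, h1⟩
  · exact Or.inl h1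
  · exact Or.inr ⟨(k, x), ⟨hk, trivial⟩, h1⟩

/-- The endpoint of a path is determined by its word alone, whatever `X` is, and there are finitely
many short words. -/
theorem finite_near (K : ℕ) :
    {m | ∃ (X : Set N) (h : List (A × Ω)), W.IsPath X W.root h m ∧ h.length < K}.Finite := by
  refine ((List.finite_length_lt (A × Ω) K).image
    fun h => h.foldl (fun k x => W.child k x.1 x.2) W.root).subset ?_
  rintro m ⟨X, h, hp, hK⟩
  exact ⟨h, hK, hp.eq_foldl.symm⟩

theorem pathProb_nonneg (π : N → ↥(stdSimplex ℝ A)) (n : N) (h : List (A × Ω)) :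
    0 ≤ W.pathProb π n h := by
  induction h generalizing n with
  | nil => exact zero_le_one
  | cons x h ih =>
    exact mul_nonneg (mul_nonneg (M.obsProb_nonneg _ _ _) ((π n).2.1 _)) (ih _)

/-- Summing over all words, legal or not, gives total mass exactly one; paths to a given node are
then a subfamily of nonnegative terms. -/
theorem sum_pathProb_ofFn (π : N → ↥(stdSimplex ℝ A)) (k : ℕ) (n : N) :
    ∑ v : Fin k → A × Ω, W.pathProb π n (List.ofFn v) = 1 := by
  induction k generalizing n with
  | zero => simp [pathProb]
  | succ k ih =>
    rw [← (Fin.consEquiv fun _ : Fin (k + 1) => A × Ω).sum_comp, Fintype.sum_prod_type]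
    have h1 : ∀ (x : A × Ω) (v : Fin k → A × Ω),
        W.pathProb π n (List.ofFn (Fin.consEquiv (fun _ : Fin (k + 1) => A × Ω) (x, v))) =
          M.obsProb (W.bel n) x.1 x.2 * (π n).1 x.1 *
            W.pathProb π (W.child n x.1 x.2) (List.ofFn v) := by
      intro x v
      simp [Fin.consEquiv, List.ofFn_succ, pathProb]
    simp only [h1, ← Finset.mul_sum, ih, mul_one, Fintype.sum_prod_type, ← Finset.sum_mul,
      M.sum_obsProb, one_mul]
    exact (π n).2.2

theorem hasSum_weighted_pathProb (π : N → ↥(stdSimplex ℝ A)) (n : N) {w : ℕ → ℝ} {c : ℝ}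
    (hw : ∀ k, 0 ≤ w k) (hc : HasSum w c) :
    HasSum (fun h : List (A × Ω) => w h.length * W.pathProb π n h) c := by
  rw [← List.equivSigmaTuple.symm.hasSum_iff]
  have hfib : ∀ k, HasSum (fun v : Fin k → A × Ω =>
      w (List.ofFn v).length * W.pathProb π n (List.ofFn v)) (w k) := by
    intro k
    have h := hasSum_fintype fun v : Fin k → A × Ω =>
      w (List.ofFn v).length * W.pathProb π n (List.ofFn v)
    simp only [List.length_ofFn, ← Finset.mul_sum, W.sum_pathProb_ofFn, mul_one] at h ⊢
    exact h
  have hs : Summable ((fun h : List (A × Ω) => w h.length * W.pathProb π n h) ∘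
      List.equivSigmaTuple.symm) := by
    refine (summable_sigma_of_nonneg fun x => mul_nonneg (hw _) (W.pathProb_nonneg _ _ _)).2
      ⟨fun k => (hfib k).summable, ?_⟩
    exact hc.summable.congr fun k => ((hfib k).tsum_eq).symm
  have h2 := hs.hasSum.sigma hfib
  rw [hc.unique h2]
  exact hs.hasSum

theorem summable_Psi (G : W.Graph) (π : N → ↥(stdSimplex ℝ A)) (n : N) :
    Summable fun h : {h : List (A × Ω) // W.IsPath G.expanded W.root h n} =>
      M.discount ^ h.1.length * W.pathProb π W.root h.1 :=
  (W.hasSum_weighted_pathProb π W.root (fun k => pow_nonneg M.discount_nonneg k)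
    M.hasSum_discount_pow).summable.subtype {h | W.IsPath G.expanded W.root h n}

theorem le_Psi (G : W.Graph) (π : N → ↥(stdSimplex ℝ A)) {n : N} {h : List (A × Ω)}
    (hp : W.IsPath G.expanded W.root h n) :
    M.discount ^ h.length * W.pathProb π W.root h ≤ W.Psi G π n :=
  (W.summable_Psi G π n).le_tsum ⟨h, hp⟩ fun _ _ =>
    mul_nonneg (pow_nonneg M.discount_nonneg _) (W.pathProb_nonneg _ _ _)

theorem Psi_nonneg (G : W.Graph) (π : N → ↥(stdSimplex ℝ A)) (n : N) : 0 ≤ W.Psi G π n :=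
  tsum_nonneg fun _ => mul_nonneg (pow_nonneg M.discount_nonneg _) (W.pathProb_nonneg _ _ _)

theorem Psi_le_of_le_length (G : W.Graph) (π : N → ↥(stdSimplex ℝ A)) {n : N} {K : ℕ}
    (hK : ∀ h, W.IsPath G.expanded W.root h n → K ≤ h.length) :
    W.Psi G π n ≤ (1 - M.discount)⁻¹ * M.discount ^ K := by
  -- Cutting the weights off below `K` leaves the tail of the geometric series, and changes no term
  -- of `Psi`.
  let w : ℕ → ℝ := fun k => if K ≤ k then M.discount ^ k else 0
  have hw : ∀ k, 0 ≤ w k := fun k => by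
    dsimp only [w]
    split_ifs
    exacts [pow_nonneg M.discount_nonneg k, le_rfl]
  have hsum : HasSum w ((1 - M.discount)⁻¹ * M.discount ^ K) := by
    have h1 : HasSum (fun k => w (k + K)) ((1 - M.discount)⁻¹ * M.discount ^ K) := by
      simpa [w, pow_add] using M.hasSum_discount_pow.mul_right (M.discount ^ K)
    have h2 := (hasSum_nat_add_iff K).1 h1
    rwa [Finset.sum_eq_zero fun i hi => if_neg (Finset.mem_range.1 hi).not_ge, add_zero] at h2
  have h1 := W.hasSum_weighted_pathProb π W.root hw hsum
  rw [← h1.tsum_eq]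
  refine le_trans (le_of_eq ?_) (h1.summable.tsum_subtype_le _
    {h | W.IsPath G.expanded W.root h n} fun h => mul_nonneg (hw _) (W.pathProb_nonneg _ _ _))
  refine tsum_congr fun h => ?_
  simp only [w, if_pos (hK h.1 h.2)]

/-! ### Progress and termination -/

/-- As long as the gap at `n` is large, following the greedy actions and the worst observations leads to a
node outside the graph whose discounted path probability is bounded below uniformly in the graph. -/
theorem exists_path_of_lt_gap {U L : Belief S → ℝ} {ε D c : ℝ} (hε : 0 < ε) (hD0 : 0 ≤ D)
    (hD : ∀ b, U b - L b ≤ D) (hc : 0 < c) (k : ℕ) (n : N) :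
    ∃ δ : ℝ, 0 < δ ∧ ∀ (G : W.Graph) (π : N → ↥(stdSimplex ℝ A)) (α : N → A),
      (∀ m ∈ G.expanded, W.IsGreedy (W.graphValue G U) m (α m)) →
      (∀ m ∈ G.expanded, ε < W.gap U L G m → c ≤ (π m).1 (α m)) →
      M.discount ^ k * D < W.gap U L G n → ε < W.gap U L G n →
      ∃ h m, W.IsPath G.expanded n h m ∧ m ∉ G.expanded ∧ ε < W.gap U L G m ∧
        δ ≤ M.discount ^ h.length * W.pathProb π n h := by
  induction k generalizing n with
  | zero =>
    -- Vacuous: no gap exceeds `D`.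
    refine ⟨1, one_pos, fun G _ _ _ _ h _ => ?_⟩
    rw [pow_zero, one_mul] at h
    exact absurd (W.gap_le G hD0 hD n) h.not_ge
  | succ k ih =>
    choose δ hδ0 hδ using fun x : A × Ω => ih (W.child n x.1 x.2)
    -- One `d` serves all edges out of `n`, since there are finitely many. Children do not depend on
    -- the graph, hence neither does `d`.
    have hev : ∀ᶠ d : ℝ in 𝓝[>] 0, ∀ x : A × Ω, 0 < M.discount → 0 < M.obsProb (W.bel n) x.1 x.2 →
        d ≤ M.discount * M.obsProb (W.bel n) x.1 x.2 * c * δ x := by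
      refine eventually_all.2 fun x => ?_
      by_cases hx : 0 < M.discount ∧ 0 < M.obsProb (W.bel n) x.1 x.2
      · have hpos := mul_pos (mul_pos (mul_pos hx.1 hx.2) hc) (hδ0 x)
        filter_upwards [Ioc_mem_nhdsGT hpos] with d hd _ _ using hd.2
      · exact Eventually.of_forall fun d h1 h2 => absurd ⟨h1, h2⟩ hx
    obtain ⟨d, ⟨hd, hd1⟩, hd0⟩ :=
      ((hev.and (Ioc_mem_nhdsGT (zero_lt_one (α := ℝ)))).and self_mem_nhdsWithin).exists
    refine ⟨d, hd0, fun G π α hα hπ hk hn => ?_⟩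
    by_cases hX : n ∈ G.expanded
    · obtain ⟨o, ho, hgap⟩ := W.exists_gap_le_discount_mul G U L hX (hα n hX)
      have hγ : 0 < M.discount := M.discount_nonneg.lt_of_ne fun h0 => by
        rw [← h0, zero_mul] at hgap
        linarith
      -- The gap has grown by a factor $1/\gamma$, which pays for one power of $\gamma$ in the
      -- threshold.
      have hk' : M.discount ^ k * D < W.gap U L G (W.child n (α n) o) := by
        refine lt_of_mul_lt_mul_left ?_ M.discount_nonneg
        rw [← mul_assoc, ← pow_succ']
        exact hk.trans_le hgap
      have hpos : 0 < W.gap U L G (W.child n (α n) o) :=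
        (mul_nonneg (pow_nonneg M.discount_nonneg k) hD0).trans_lt hk'
      have hn' := hn.trans_le (hgap.trans (mul_le_of_le_one_left hpos.le M.discount_lt_one.le))
      obtain ⟨h, m, hp, hm, hgm, hle⟩ := hδ (α n, o) G π α hα hπ hk' hn'
      refine ⟨(α n, o) :: h, m, ⟨hX, (hα n hX).1, ho, hp⟩, hm, hgm, ?_⟩
      refine (hd (α n, o) hγ ho).trans ?_
      have h1 : M.discount * M.obsProb (W.bel n) (α n) o * c ≤
          M.discount * M.obsProb (W.bel n) (α n) o * (π n).1 (α n) :=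
        mul_le_mul_of_nonneg_left (hπ n hX hn) (mul_pos hγ ho).le
      refine (mul_le_mul h1 hle (hδ0 _).le
        (mul_nonneg (mul_pos hγ ho).le ((π n).2.1 _))).trans_eq ?_
      simp only [List.length_cons, pathProb]
      ring
    -- The empty path has weight one, which is why `d ≤ 1` was imposed.
    · exact ⟨[], n, rfl, hX, hn, by simpa [pathProb] using hd1.2⟩

theorem exists_expand (G : W.Graph) {n : N} (hn : n ∈ W.fringe G) :
    ∃ G' : W.Graph, G'.expanded = insert n G.expanded := by
  refine ⟨⟨insert n G.expanded, G.finite.insert n, fun m hm => ?_⟩, rfl⟩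
  rcases hm with rfl | hm
  · exact hn.1.imp fun h hp => hp.mono _ (Set.subset_insert _ _)
  · exact (G.reachable m hm).imp fun h hp => hp.mono _ (Set.subset_insert _ _)

theorem exists_isRun (U L : Belief S → ℝ) (ε : ℝ) (π : W.Graph → N → ↥(stdSimplex ℝ A)) :
    ∃ G : ℕ → W.Graph, W.IsRun U L ε π G := by
  have hstep : ∀ G : W.Graph, ∃ G' : W.Graph,
      ((ε < W.gap U L G W.root ∧ (W.fringe G).Nonempty) →
        ∃ n ∈ W.fringe G,
          (∀ m ∈ W.fringe G, W.contribution U L G (π G) m ≤ W.contribution U L G (π G) n) ∧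
          G'.expanded = insert n G.expanded) ∧
      (¬ (ε < W.gap U L G W.root ∧ (W.fringe G).Nonempty) → G' = G) := by
    intro G
    by_cases h : ε < W.gap U L G W.root ∧ (W.fringe G).Nonempty
    · obtain ⟨n, hn, hmax⟩ :=
        Set.exists_max_image _ (W.contribution U L G (π G)) (W.finite_fringe G) h.2
      obtain ⟨G', hG'⟩ := W.exists_expand G hn
      exact ⟨G', fun _ => ⟨n, hn, hmax, hG'⟩, fun h' => absurd h h'⟩
    · exact ⟨G, fun h' => absurd h' h, fun _ => rfl⟩
  choose next hnext using hstep
  let start : W.Graph := ⟨∅, Set.finite_empty, fun _ h => h.elim⟩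
  exact ⟨fun t => next^[t] start, rfl, fun t => by
    simpa only [Function.iterate_succ_apply'] using hnext (next^[t] start)⟩

/-- An execution of AEMS-Loop closes the gap at the root after finitely many expansions. -/
theorem IsRun.exists_gap_le {U L : Belief S → ℝ} {ε D c : ℝ} (hε : 0 < ε)
    (hD : ∀ b, U b - L b ≤ D) {π : W.Graph → N → ↥(stdSimplex ℝ A)} {α : W.Graph → N → A}
    (hα : ∀ G : W.Graph, ∀ n ∈ G.expanded, W.IsGreedy (W.graphValue G U) n (α G n)) (hc : 0 < c)
    (hπ : ∀ G : W.Graph, ∀ n ∈ G.expanded, ε < W.gap U L G n → c ≤ (π G n).1 (α G n))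
    {G : ℕ → W.Graph} (hG : W.IsRun U L ε π G) : ∃ T, W.gap U L (G T) W.root ≤ ε := by
  by_contra! hgap
  wlog hD0 : 0 < D generalizing D
  · exact this (D := 1) (fun b => (hD b).trans (by linarith)) one_pos
  obtain ⟨k, hk⟩ : ∃ k : ℕ, M.discount ^ k * D < ε := by
    obtain ⟨k, hk⟩ := exists_pow_lt_of_lt_one (div_pos hε hD0) M.discount_lt_one
    exact ⟨k, (lt_div_iff₀ hD0).1 hk⟩
  obtain ⟨δ, hδ0, hδ⟩ := W.exists_path_of_lt_gap hε hD0.le hD hc k W.root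
  have hlow : ∀ t, ∃ m ∈ W.fringe (G t), δ * ε ≤ W.contribution U L (G t) (π (G t)) m := by
    intro t
    obtain ⟨h, m, hp, hm, hgm, hle⟩ :=
      hδ (G t) (π (G t)) (α (G t)) (hα _) (hπ _) (hk.trans (hgap t)) (hgap t)
    rw [W.gap_of_notMem _ _ _ hm] at hgm
    exact ⟨m, ⟨⟨h, hp⟩, hm⟩, mul_le_mul (hle.trans (W.le_Psi _ _ hp)) hgm.le hε.le
      (W.Psi_nonneg _ _ _)⟩
  -- `x t` is the node expanded at time `t`; `hlow` also shows that the fringe is never empty, so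
  -- the run does not halt.
  choose x hx hmax hsucc using fun t =>
    (hG.2 t).1 ⟨hgap t, (hlow t).imp fun _ h => h.1⟩
  obtain ⟨K, hK⟩ : ∃ K : ℕ, (1 - M.discount)⁻¹ * M.discount ^ K * D < δ * ε := by
    have hpos : 0 < (1 - M.discount)⁻¹ * D :=
      mul_pos (inv_pos.2 (sub_pos.2 M.discount_lt_one)) hD0
    obtain ⟨K, hK⟩ := exists_pow_lt_of_lt_one (div_pos (mul_pos hδ0 hε) hpos) M.discount_lt_one
    refine ⟨K, ?_⟩
    have := (lt_div_iff₀ hpos).1 hK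
    linarith
  have hnear : ∀ t, ∃ (X : Set N) (h : List (A × Ω)), W.IsPath X W.root h (x t) ∧ h.length < K := by
    intro t
    by_contra! hfar
    -- By maximality, `x t` contributes at least `δ * ε`, too much for a node that is far from the
    -- root.
    obtain ⟨m, hm, hle⟩ := hlow t
    have h1 := W.Psi_le_of_le_length (G t) (π (G t)) (hfar (G t).expanded)
    have h2 := hle.trans (hmax t m hm)
    have h3 : W.contribution U L (G t) (π (G t)) (x t) ≤ W.Psi (G t) (π (G t)) (x t) * D :=
      mul_le_mul_of_nonneg_left (hD _) (W.Psi_nonneg _ _ _)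
    linarith [mul_le_mul_of_nonneg_right h1 hD0.le]
  have hmono : Monotone fun t => (G t).expanded :=
    monotone_nat_of_le_succ fun t => by
      rw [hsucc t]
      exact Set.subset_insert _ _
  have hne : ∀ s t, s < t → x s ≠ x t := by
    intro s t hst heq
    refine (hx t).2 (heq ▸ hmono (Nat.succ_le_of_lt hst) ?_)
    change x s ∈ (G (s + 1)).expanded
    rw [hsucc s]
    exact Set.mem_insert _ _
  have hinj : Function.Injective x := fun s t h => by
    rcases lt_trichotomy s t with h1 | h1 | h1
    exacts [absurd h (hne s t h1), h1, absurd h.symm (hne t s h1)]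
  exact Set.infinite_of_injective_forall_mem hinj hnear (W.finite_near K)

end SearchSpace

theorem theorem2 {S Ω A N : Type*} [Fintype S] [Fintype Ω] [Fintype A]
    (M : POMDP S Ω A) (b₀ : Belief S) (W : SearchSpace M b₀ N)
    (U L : Belief S → ℝ) (hU : BddAbove (Set.range U)) (hL : BddBelow (Set.range L))
    (hUV : ∀ b, M.optValue b ≤ U b) (hLV : ∀ b, L b ≤ M.optValue b)
    (ε : ℝ) (hε : 0 < ε)
    (pihat : W.Graph → N → ↥(stdSimplex ℝ A))
    (ahat : W.Graph → N → A)
    (hahat : ∀ (G : W.Graph), ∀ n ∈ G.expanded, W.IsGreedy (W.graphValue G U) n (ahat G n))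
    (hpihat : ∃ c : ℝ, 0 < c ∧ ∀ (G : W.Graph), ∀ n ∈ G.expanded,
      ε < W.gap U L G n → c ≤ (pihat G n).1 (ahat G n)) :
    (∃ G : ℕ → W.Graph, W.IsRun U L ε pihat G) ∧
    ∀ G : ℕ → W.Graph, W.IsRun U L ε pihat G →
      ∃ T : ℕ,
        W.graphValue (G T) U W.root - W.graphValue (G T) L W.root ≤ ε ∧
        W.graphValue (G T) L W.root ≤ M.optValue b₀ ∧
        M.optValue b₀ ≤ W.graphValue (G T) U W.root ∧
        M.optValue b₀ - W.graphValue (G T) L W.root ≤ ε ∧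
        (W.root ∈ (G T).expanded → ∀ a : A,
          W.IsGreedy (W.graphValue (G T) L) W.root a → M.optValue b₀ - ε ≤ M.optQ b₀ a) := by
  refine ⟨W.exists_isRun U L ε pihat, fun G hG => ?_⟩
  obtain ⟨u, hu⟩ := hU
  obtain ⟨l, hl⟩ := hL
  obtain ⟨c, hc, hpi⟩ := hpihat
  obtain ⟨T, hT⟩ := hG.exists_gap_le W (D := u - l) hε
    (fun b => sub_le_sub (hu ⟨b, rfl⟩) (hl ⟨b, rfl⟩)) hahat hc hpi
  have hup := W.optValue_le_graphValue (G T) hUV W.root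
  have hlow := W.graphValue_le_optValue (G T) hLV W.root
  rw [W.bel_root] at hup hlow
  rw [SearchSpace.gap] at hT
  refine ⟨T, hT, hlow, hup, by linarith, fun hroot a ha => ?_⟩
  -- The lower value of the root is its backup along `a`, which is at most $Q^*(b_0,a)$ by
  -- monotonicity.
  have h1 := W.graphValue_eq_backup (G T) L hroot ha
  have h2 := W.backup_mono (W.graphValue_le_optValue (G T) hLV) W.root a
  rw [W.backup_optValue ha.1, W.bel_root] at h2
  linarith
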